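/- Let $T$ be a finite tree (the null graph, with no vertices, also counts as a tree), let $G$ be a finite simple graph, let $S\subseteq V(G)$, and let $k$ be a positive integer. An $S$-rooted model of $T$ in a graph $G$ is a family $(B_x)_{x\in V(T)}$ of pairwise disjoint subsets of $V(G)$ such that each $B_x$ induces a non-empty connected subgraph of $G$, $B_x\cap S\neq\emptyset$ for every $x\in V(T)$, and for every edge $xy$ of $T$ there is an edge of $G$ between $B_x$ and $B_y$. Models in a family $(M_i)_{i}$ are vertex-disjoint if, for all $i\neq j$, the union of the branch sets of $M_i$ is disjoint from the union of the branch sets of $M_j$. Then at least one of the following holds: 1. there is a family of $k$ vertex-disjoint $S$-rooted models of $T$ in $G$; 2. there is a set $Z\subseteq V(G)$ with $|Z|\le (2k|V(T)|-1)(k-1)$ such that $G-Z$ has no $S$-rooted model of $T$, that is, no $(S\setminus Z)$-rooted model of $T$. -/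

import Mathlib

namespace RootedMinor

/-- `B` is a model of `H` in `G`: its branch sets are pairwise disjoint, each of them induces a
non-empty connected subgraph of `G` (Mathlib's `Connected` includes non-emptiness), and for every
edge of `H` there is an edge of `G` between the corresponding branch sets. -/
structure IsModel {W V : Type*} (H : SimpleGraph W) (G : SimpleGraph V) (B : W → Set V) :
    Prop where
  disjoint : ∀ x y, x ≠ y → Disjoint (B x) (B y)
  connected : ∀ x, (G.induce (B x)).Connected
  adj : ∀ x y, H.Adj x y → ∃ u ∈ B x, ∃ v ∈ B y, G.Adj u v

/-- `B` is an `S`-rooted model of `H` in `G`: a model, every branch set of which meets `S`. -/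
structure IsRootedModel {W V : Type*} (H : SimpleGraph W) (G : SimpleGraph V) (S : Set V)
    (B : W → Set V) : Prop extends IsModel H G B where
  rooted : ∀ x, (B x ∩ S).Nonempty

/-- `H` has an `S`-rooted model in `G`. -/
def HasRootedModel {W V : Type*} (H : SimpleGraph W) (G : SimpleGraph V) (S : Set V) : Prop :=
  ∃ B : W → Set V, IsRootedModel H G S B

/-- `G` has `k` vertex-disjoint `S`-rooted models of `H`: a family of `k` models such that the
vertex sets (unions of the branch sets) of any two of them are disjoint. -/
def HasDisjointRootedModels {W V : Type*} (H : SimpleGraph W) (G : SimpleGraph V) (S : Set V)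
    (k : ℕ) : Prop :=
  ∃ B : Fin k → W → Set V, (∀ i, IsRootedModel H G S (B i)) ∧
    ∀ i j, i ≠ j → Disjoint (⋃ x, B i x) (⋃ x, B j x)

end RootedMinor

namespace RootedMinor

/-! Let `m + 1 = k * |W|` and let `kT` be the forest of `k` disjoint copies of `T`. The theorem
follows from a dichotomy (`sweepable_univ_or_hasRootedModel`): either `G` has an `S`-rooted model of
`kT`, which splits into `k` disjoint models of `T`, or `V` can be swept by increasing sets whose
steps have bags of size at most `m`.

The dichotomy adapts Diestel's proof of the path-width theorem. A model of part of the forest is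
grown inside a maximal sweepable set `X`, one branch set per boundary vertex. A leaf of the rest is
added at a vertex outside `X`, and Menger's theorem carries all branch sets to the boundary of a
larger maximal set. The last linkage goes to `S` instead and roots all branch sets at once. A
missing linkage would yield a sweepable set contradicting maximality; submodularity of the boundary
(`Sweepable.inter`) is what makes that set sweepable.

Along a sweep, models of `T` are packed greedily (`Sweepable.exists_packing`). Each packed model
costs two bags, so fewer than `k` packed models leave a hitting set of size at most `2 * m * (k -
1)`. -/

variable {V W : Type*}

/-- The inner boundary of `X`: the vertices of `X` with a neighbour outside `X`. -/
def boundary (G : SimpleGraph V) (X : Set V) : Set V :=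
  {v | v ∈ X ∧ ∃ w, w ∉ X ∧ G.Adj v w}

/-- The graph on all of `V` that keeps only the edges of `G` with both ends in `R`. -/
def within (G : SimpleGraph V) (R : Set V) : SimpleGraph V where
  Adj a b := G.Adj a b ∧ a ∈ R ∧ b ∈ R
  symm := ⟨fun _ _ h => ⟨h.1.symm, h.2.2, h.2.1⟩⟩
  loopless := ⟨fun _ h => G.loopless.irrefl _ h.1⟩

lemma within_le (G : SimpleGraph V) (R : Set V) : within G R ≤ G := fun _ _ h => h.1

lemma boundary_subset (G : SimpleGraph V) (X : Set V) : boundary G X ⊆ X := fun _ h => h.1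

lemma induce_connected_mono {G H : SimpleGraph V} (h : G ≤ H) {U : Set V}
    (hU : (G.induce U).Connected) : (H.induce U).Connected :=
  hU.mono fun _ _ hab => h hab

lemma induce_singleton_connected (G : SimpleGraph V) (v : V) :
    (G.induce ({v} : Set V)).Connected :=
  { preconnected := .of_subsingleton, nonempty := ⟨⟨v, rfl⟩⟩ }

/-- A connected set that meets `X` and has no edge leaving `X` lies in `X`. -/
lemma subset_of_connected {G : SimpleGraph V} {U X : Set V} (hU : (G.induce U).Connected)
    (hmeet : (U ∩ X).Nonempty)
    (hclosed : ∀ a ∈ U, ∀ b ∈ U, a ∈ X → G.Adj a b → b ∈ X) : U ⊆ X := by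
  obtain ⟨u, huU, huX⟩ := hmeet
  intro v hv
  obtain ⟨p⟩ := hU.preconnected ⟨u, huU⟩ ⟨v, hv⟩
  have key : ∀ (a b : U), (G.induce U).Walk a b → (a : V) ∈ X → (b : V) ∈ X := by
    intro a b p
    induction p with
    | nil => exact id
    | cons h _ ih => exact fun ha => ih (hclosed _ (Subtype.coe_prop _) _ (Subtype.coe_prop _) ha h)
  exact key _ _ p huX

lemma subset_of_connected_within {G : SimpleGraph V} {U R : Set V}
    (hU : ((within G R).induce U).Connected) (hmeet : (U ∩ R).Nonempty) : U ⊆ R :=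
  subset_of_connected hU hmeet fun _ _ _ _ _ h => h.2.2

/-! ### Menger's theorem for connected sets -/

/-- There are `k` pairwise disjoint connected sets, each meeting both `A` and `B`. -/
def Linked (G : SimpleGraph V) (A B : Set V) (k : ℕ) : Prop :=
  ∃ (I : Set V) (C : V → Set V), I.ncard = k ∧
    (∀ i ∈ I, (G.induce (C i)).Connected ∧ (C i ∩ A).Nonempty ∧ (C i ∩ B).Nonempty) ∧
    ∀ i ∈ I, ∀ j ∈ I, i ≠ j → Disjoint (C i) (C j)

lemma Linked.symm {G : SimpleGraph V} {A B : Set V} {k : ℕ} (h : Linked G A B k) :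
    Linked G B A k := by
  obtain ⟨I, C, hI, hC, hd⟩ := h
  exact ⟨I, C, hI, fun i hi => ⟨(hC i hi).1, (hC i hi).2.2, (hC i hi).2.1⟩, hd⟩

/-- A linkage onto a set of exactly `k` vertices can be indexed by that set. -/
lemma Linked.index [Finite V] {G : SimpleGraph V} {A M : Set V} {k : ℕ} (h : Linked G M A k)
    (hM : M.ncard = k) :
    ∃ C : V → Set V,
      (∀ m ∈ M, m ∈ C m ∧ (G.induce (C m)).Connected ∧ (C m ∩ A).Nonempty) ∧
      ∀ m ∈ M, ∀ m' ∈ M, m ≠ m' → Disjoint (C m) (C m') := by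
  classical
  obtain ⟨I, C, hI, hC, hd⟩ := h
  have hex : ∀ i, ∃ v, i ∈ I → v ∈ C i ∩ M := fun i => by
    by_cases hi : i ∈ I
    · obtain ⟨v, hv⟩ := (hC i hi).2.1
      exact ⟨v, fun _ => hv⟩
    · exact ⟨i, fun h => absurd h hi⟩
  choose f hf using hex
  have hinj : Set.InjOn f I := by
    intro i hi j hj hij
    by_contra hne
    exact Set.disjoint_left.1 (hd i hi j hj hne) (hf i hi).1 (hij ▸ (hf j hj).1)
  have himg : f '' I = M := by
    apply Set.eq_of_subset_of_ncard_le
    · rintro _ ⟨i, hi, rfl⟩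
      exact (hf i hi).2
    · rw [hinj.ncard_image, hM, hI]
    · exact Set.toFinite M
  have hex2 : ∀ m, ∃ i, m ∈ M → i ∈ I ∧ f i = m := fun m => by
    by_cases hm : m ∈ M
    · rw [← himg] at hm
      obtain ⟨i, hi⟩ := hm
      exact ⟨i, fun _ => hi⟩
    · exact ⟨m, fun h => absurd h hm⟩
  choose g hg using hex2
  refine ⟨fun m => C (g m), fun m hm => ⟨?_, (hC _ (hg m hm).1).1, (hC _ (hg m hm).1).2.2⟩, ?_⟩
  · have := (hf _ (hg m hm).1).1
    rwa [(hg m hm).2] at this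
  · intro m hm m' hm' hne
    refine hd _ (hg m hm).1 _ (hg m' hm').1 fun h => hne ?_
    rw [← (hg m hm).2, ← (hg m' hm').2, h]

/-- Menger's theorem, for connected sets in place of paths. A cut is given by a set `Y ⊇ A`; its
separator consists of the boundary of `Y` and of the vertices of `B` in `Y`. -/
theorem menger [Finite V] (G : SimpleGraph V) : ∀ (A B : Set V) (k : ℕ),
    (∀ Y, A ⊆ Y → k ≤ (boundary G Y ∪ (B ∩ Y)).ncard) → Linked G A B k := by
  classical
  induction G using WellFoundedLT.induction with
  | ind G ih =>
  intro A B k hcut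
  by_cases hbot : ∀ x y, ¬ G.Adj x y
  · have h1 := hcut A subset_rfl
    have h2 : boundary G A ∪ (B ∩ A) = B ∩ A := by
      rw [Set.union_eq_right]
      rintro v ⟨_, w, _, h⟩
      exact absurd h (hbot _ _)
    rw [h2] at h1
    obtain ⟨I, hI, hIk⟩ := Set.exists_subset_card_eq h1
    refine ⟨I, fun v => {v}, hIk, fun i hi => ⟨induce_singleton_connected G i,
      ⟨i, rfl, (hI hi).2⟩, ⟨i, rfl, (hI hi).1⟩⟩, fun i _ j _ hij => by simpa using hij⟩
  push Not at hbot
  obtain ⟨x₀, y₀, hxy₀⟩ := hbot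
  -- Induction on the edge set. If deleting one edge destroys the cut condition, the small separator
  -- `M` of the smaller graph becomes a separator of size `k` of `G` on adding either end of that
  -- edge. Linkages on the two sides are then glued at `M` and along the edge.
  set G₁ := G.deleteEdges {s(x₀, y₀)} with hG₁
  have hG₁adj : ∀ a b, G₁.Adj a b ↔ G.Adj a b ∧ s(a, b) ≠ s(x₀, y₀) := fun a b => by
    simp [hG₁, SimpleGraph.deleteEdges_adj]
  have hlt : ∀ H : SimpleGraph V, H ≤ G → ∀ a b, G.Adj a b → ¬ H.Adj a b → H < G :=
    fun H hle a b hab hn => lt_of_le_not_ge hle fun h => hn (h hab)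
  by_cases hc : ∀ Y, A ⊆ Y → k ≤ (boundary G₁ Y ∪ (B ∩ Y)).ncard
  · have hle : G₁ ≤ G := fun a b h => ((hG₁adj a b).1 h).1
    obtain ⟨I, C, hI, hC, hd⟩ := ih G₁ (hlt _ hle x₀ y₀ hxy₀ (by simp [hG₁adj])) A B k hc
    exact ⟨I, C, hI, fun i hi => ⟨induce_connected_mono hle (hC i hi).1, (hC i hi).2⟩, hd⟩
  push Not at hc
  obtain ⟨Y, hAY, hYk⟩ := hc
  set M := boundary G₁ Y ∪ (B ∩ Y) with hM
  have hMY : M ⊆ Y := Set.union_subset (boundary_subset _ _) Set.inter_subset_right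
  obtain ⟨x, y, hxy, he, hxY, hyY, hxM⟩ : ∃ x y, G.Adj x y ∧ s(x, y) = s(x₀, y₀) ∧ x ∈ Y ∧ y ∉ Y ∧
      x ∉ M := by
    by_contra hno
    push Not at hno
    refine absurd (hcut Y hAY) (not_le.2 (lt_of_le_of_lt (Set.ncard_le_ncard ?_) hYk))
    rintro v (⟨hv, w, hw, hvw⟩ | hv)
    · by_cases h : s(v, w) = s(x₀, y₀)
      · exact hno v w hvw h hv hw
      · exact Or.inl ⟨hv, w, hw, (hG₁adj _ _).2 ⟨hvw, h⟩⟩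
    · exact Or.inr hv
  have hcross : ∀ a b, a ∈ Y → b ∉ Y → G.Adj a b → a ∈ M ∨ (a = x ∧ b = y) := by
    intro a b ha hb hab
    by_cases h : s(a, b) = s(x₀, y₀)
    · right
      rw [← he, Sym2.eq_iff] at h
      rcases h with h | h
      · exact h
      · exact absurd (h.1 ▸ ha) hyY
    · exact Or.inl (Or.inl ⟨ha, b, hb, (hG₁adj _ _).2 ⟨hab, h⟩⟩)
  have hyM : y ∉ M := fun h => hyY (hMY h)
  have hcx : (insert x M).ncard = M.ncard + 1 := Set.ncard_insert_of_notMem hxM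
  have hcy : (insert y M).ncard = M.ncard + 1 := Set.ncard_insert_of_notMem hyM
  have hbdY : boundary G Y ∪ (B ∩ Y) ⊆ insert x M := by
    rintro v (⟨hv, w, hw, hvw⟩ | hv)
    · rcases hcross v w hv hw hvw with h | h
      · exact Or.inr h
      · exact Or.inl h.1
    · exact Or.inr (Or.inr hv)
  have hk : M.ncard + 1 = k := by
    have := (hcut Y hAY).trans (Set.ncard_le_ncard hbdY)
    omega
  set Q := Yᶜ ∪ M with hQ
  have hxQ : x ∉ Q := by
    rintro (h | h)
    exacts [h hxY, hxM h]
  have L1 : Linked (within G Y) A (insert x M) k := by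
    refine ih _ (hlt _ (within_le _ _) x y hxy fun h => hyY h.2.2) _ _ _ fun Y' hAY' => ?_
    refine (hcut (Y' ∩ Y) (Set.subset_inter hAY' hAY)).trans (Set.ncard_le_ncard ?_)
    rintro a (⟨⟨haY', haY⟩, b, hb, hab⟩ | ⟨haB, haY', haY⟩)
    · by_cases hbY : b ∈ Y
      · exact Or.inl ⟨haY', b, fun h => hb ⟨h, hbY⟩, hab, haY, hbY⟩
      · exact Or.inr ⟨hbdY (Or.inl ⟨haY, b, hbY, hab⟩), haY'⟩
    · exact Or.inr ⟨Or.inr (Or.inr ⟨haB, haY⟩), haY'⟩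
  have L2 : Linked (within G Q) (insert y M) B k := by
    refine ih _ (hlt _ (within_le _ _) x y hxy fun h => hxQ h.2.1) _ _ _ fun Y' hY' => ?_
    refine (hcut (Y ∪ Y') (hAY.trans Set.subset_union_left)).trans (Set.ncard_le_ncard ?_)
    rintro a (⟨haYY, b, hb, hab⟩ | ⟨haB, haYY⟩)
    · have hbY : b ∉ Y := fun h => hb (Or.inl h)
      have hbY' : b ∉ Y' := fun h => hb (Or.inr h)
      by_cases haY : a ∈ Y
      · rcases hcross a b haY hbY hab with h | h
        · exact Or.inl ⟨hY' (Or.inr h), b, hbY', hab, Or.inr h, Or.inl hbY⟩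
        · exact absurd (hY' (Or.inl h.2)) hbY'
      · exact Or.inl ⟨haYY.resolve_left haY, b, hbY', hab, Or.inl haY, Or.inl hbY⟩
    · by_cases haY : a ∈ Y
      · exact Or.inr ⟨haB, hY' (Or.inr (Or.inr ⟨haB, haY⟩))⟩
      · exact Or.inr ⟨haB, haYY.resolve_left haY⟩
  obtain ⟨C, hC, hCd⟩ := L1.symm.index (hcx.trans hk)
  obtain ⟨D, hD, hDd⟩ := L2.index (hcy.trans hk)
  have hCY : ∀ m ∈ insert x M, C m ⊆ Y := fun m hm =>
    subset_of_connected_within (hC m hm).2.1 ⟨m, (hC m hm).1, Set.insert_subset hxY hMY hm⟩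
  have hDQ : ∀ m ∈ insert y M, D m ⊆ Q := fun m hm =>
    subset_of_connected_within (hD m hm).2.1 ⟨m, (hD m hm).1, by
      rcases hm with rfl | hm
      exacts [Or.inl hyY, Or.inr hm]⟩
  -- Matches the ends of the two linkages: `M` is fixed, and `x` continues through the edge to `y`.
  let φ : V → V := fun m => if m = x then y else m
  have hφx : φ x = y := if_pos rfl
  have hφM : ∀ m ∈ M, φ m = m := fun m hm => if_neg fun h : m = x => hxM (h ▸ hm)
  have hφmem : ∀ m ∈ insert x M, φ m ∈ insert y M := by
    rintro m (rfl | hm)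
    · exact Or.inl hφx
    · rw [hφM m hm]; exact Or.inr hm
  have hφinj : ∀ m ∈ insert x M, ∀ m' ∈ insert x M, φ m = φ m' → m = m' := by
    rintro m (rfl | hm) m' (rfl | hm') h
    · rfl
    · rw [hφx, hφM _ hm'] at h; exact absurd (h ▸ hm') hyM
    · rw [hφx, hφM _ hm] at h; exact absurd (h ▸ hm) hyM
    · rwa [hφM _ hm, hφM _ hm'] at h
  have hCD : ∀ m ∈ insert x M, ∀ m' ∈ insert x M, m ≠ m' → Disjoint (C m) (D (φ m')) := by
    intro m hm m' hm' hne
    rw [Set.disjoint_left]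
    intro z hzC hzD
    -- The two sides `Y` and `Q` share only `M`, and a vertex of `M` lies in its own set of each
    -- linkage.
    have hzM : z ∈ M := (hDQ _ (hφmem m' hm') hzD).resolve_left fun h => h (hCY m hm hzC)
    have hzm : z = m := by
      by_contra h
      exact Set.disjoint_left.1 (hCd z (Or.inr hzM) m hm h) (hC z (Or.inr hzM)).1 hzC
    have hzm' : z = φ m' := by
      by_contra h
      exact Set.disjoint_left.1 (hDd z (Or.inr hzM) _ (hφmem m' hm') h) (hD z (Or.inr hzM)).1 hzD
    refine hne (hφinj m hm m' hm' ?_)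
    rw [← hzm, hφM z hzM, hzm']
  refine ⟨insert x M, fun m => C m ∪ D (φ m), hcx.trans hk, fun m hm => ⟨?_, ?_, ?_⟩, ?_⟩
  · have c1 := induce_connected_mono (within_le _ _) (hC m hm).2.1
    have c2 := induce_connected_mono (within_le _ _) (hD _ (hφmem m hm)).2.1
    rcases hm with rfl | hm
    · refine SimpleGraph.connected_induce_union c1.preconnected c2.preconnected
        (hC m (Or.inl rfl)).1 (hD _ (hφmem m (Or.inl rfl))).1 ?_
      rwa [hφx]
    · refine SimpleGraph.induce_union_connected c1.preconnected c2.preconnected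
        ⟨m, (hC m (Or.inr hm)).1, ?_⟩
      have := (hD _ (hφmem m (Or.inr hm))).1
      rw [hφM m hm] at this ⊢
      exact this
  · exact (hC m hm).2.2.mono (Set.inter_subset_inter_left _ Set.subset_union_left)
  · exact (hD _ (hφmem m hm)).2.2.mono (Set.inter_subset_inter_left _ Set.subset_union_right)
  · intro m hm m' hm' hne
    simp only [Set.disjoint_union_left, Set.disjoint_union_right]
    exact ⟨⟨hCd m hm m' hm' hne, (hCD m' hm' m hm hne.symm).symm⟩, hCD m hm m' hm' hne,
      hDd _ (hφmem m hm) _ (hφmem m' hm') fun h => hne (hφinj m hm m' hm' h)⟩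

/-! ### Sweeps and submodularity -/

/-- `Z` is the last set of an increasing sequence of vertex sets starting with `∅`, in which the
boundary of every set, together with the vertices of `S` added in the step, has size at most `m`.
If `Z` is the whole vertex set, the sets `∂X ∪ ∂Y ∪ (S ∩ (Y \ X))` for consecutive `X ⊆ Y` are the
bags of a path decomposition focused on `S`. -/
inductive Sweepable (G : SimpleGraph V) (S : Set V) (m : ℕ) : Set V → Prop
  | empty : Sweepable G S m ∅
  | step {X Y : Set V} (hX : Sweepable G S m X) (hXY : X ⊆ Y)
      (hcard : (boundary G Y ∪ (S ∩ (Y \ X))).ncard ≤ m) : Sweepable G S m Y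

lemma Sweepable.ncard_boundary_le [Finite V] {G : SimpleGraph V} {S : Set V} {m : ℕ} {X : Set V}
    (h : Sweepable G S m X) : (boundary G X).ncard ≤ m := by
  cases h with
  | empty => simp [boundary]
  | step _ _ hcard => exact (Set.ncard_le_ncard Set.subset_union_left).trans hcard

/-- Submodularity: the bag of `Z ∩ Y` and the boundary of `Y ∪ Z` together are no larger than the
bag of `Z` and the boundary of `Y`. As enlarging `Y` does not shrink its boundary, intersecting
every set of the sweep with `Y` does not enlarge any bag. -/
lemma Sweepable.inter [Finite V] {G : SimpleGraph V} {S : Set V} {m : ℕ} {Z Y : Set V}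
    (hZ : Sweepable G S m Z)
    (hY : ∀ W ⊆ Z, (boundary G Y).ncard ≤ (boundary G (Y ∪ W)).ncard) :
    Sweepable G S m (Z ∩ Y) := by
  induction hZ with
  | empty => rw [Set.empty_inter]; exact .empty
  | @step X Z hX hXZ hcard ih =>
    refine .step (ih fun W hW => hY W (hW.trans hXZ)) (Set.inter_subset_inter_left _ hXZ) ?_
    set P := boundary G (Z ∩ Y) ∪ (S ∩ ((Z ∩ Y) \ (X ∩ Y)))
    set P' := boundary G Z ∪ (S ∩ (Z \ X))
    have h1 : P ∪ boundary G (Y ∪ Z) ⊆ P' ∪ boundary G Y := by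
      rintro v ((⟨⟨hvZ, hvY⟩, w, hw, hvw⟩ | ⟨hvS, ⟨hvZ, hvY⟩, hv⟩) | ⟨hv, w, hw, hvw⟩)
      · by_cases hwZ : w ∈ Z
        · exact Or.inr ⟨hvY, w, fun h => hw ⟨hwZ, h⟩, hvw⟩
        · exact Or.inl (Or.inl ⟨hvZ, w, hwZ, hvw⟩)
      · exact Or.inl (Or.inr ⟨hvS, hvZ, fun h => hv ⟨h, hvY⟩⟩)
      · rcases hv with hv | hv
        · exact Or.inr ⟨hv, w, fun h => hw (Or.inl h), hvw⟩
        · exact Or.inl (Or.inl ⟨hv, w, fun h => hw (Or.inr h), hvw⟩)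
    have h2 : P ∩ boundary G (Y ∪ Z) ⊆ P' ∩ boundary G Y := by
      rintro v ⟨hv, -, w, hw, hvw⟩
      have hv' : v ∈ Z ∩ Y := by
        rcases hv with hv | hv
        exacts [hv.1, hv.2.1]
      exact ⟨Or.inl ⟨hv'.1, w, fun h => hw (Or.inr h), hvw⟩,
        hv'.2, w, fun h => hw (Or.inl h), hvw⟩
    have h3 := Set.ncard_le_ncard h1
    have h4 := Set.ncard_le_ncard h2
    have h5 := Set.ncard_union_add_ncard_inter P (boundary G (Y ∪ Z))
    have h6 := Set.ncard_union_add_ncard_inter P' (boundary G Y)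
    have h7 := hY Z subset_rfl
    omega

/-- If the linkage failed, Menger would give a set between `insert u X` and `X'` with boundary at
most `i`. One of minimum boundary in that range is sweepable by `Sweepable.inter`, contrary to
`hno`. -/
lemma Sweepable.linked_boundary [Finite V] {G : SimpleGraph V} {S : Set V} {m i : ℕ}
    {X X' : Set V} {u : V} (hX' : Sweepable G S m X') (hsub : insert u X ⊆ X')
    (hno : ∀ Y, Sweepable G S m Y → insert u X ⊆ Y → i < (boundary G Y).ncard) :
    Linked (within G (X' \ (X \ boundary G X))) (insert u (boundary G X)) (boundary G X')
      (i + 1) := by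
  refine menger _ _ _ _ fun Y₀ hY₀ => ?_
  by_contra hlt
  have hXX' : X ⊆ X' := (Set.subset_insert _ _).trans hsub
  have hbX : ∀ a b, a ∈ X → b ∉ X → G.Adj a b → a ∈ Y₀ := fun a b ha hb hab =>
    hY₀ (Or.inr ⟨ha, b, hb, hab⟩)
  have hY₁ : (boundary G ((Y₀ ∪ X) ∩ X')).ncard ≤ i := by
    refine (Set.ncard_le_ncard ?_).trans (Nat.lt_succ_iff.1 (not_le.1 hlt))
    rintro a ⟨⟨ha, haX'⟩, b, hb, hab⟩
    by_cases hbX' : b ∈ X'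
    · have hbY₀ : b ∉ Y₀ := fun h => hb ⟨Or.inl h, hbX'⟩
      have hbX₁ : b ∉ X := fun h => hb ⟨Or.inr h, hbX'⟩
      have haY₀ : a ∈ Y₀ := ha.elim id fun h => hbX a b h hbX₁ hab
      exact Or.inl ⟨haY₀, b, hbY₀, hab, ⟨haX', fun h => h.2 ⟨h.1, b, hbX₁, hab⟩⟩, hbX',
        fun h => hbX₁ h.1⟩
    · exact Or.inr ⟨⟨haX', b, hbX', hab⟩,
        ha.elim id fun h => hbX a b h (fun h => hbX' (hXX' h)) hab⟩
  obtain ⟨Y, ⟨hY1, hY2⟩, hmin⟩ := Set.exists_min_image {Y | insert u X ⊆ Y ∧ Y ⊆ X'}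
    (fun Y => (boundary G Y).ncard) (Set.toFinite _) ⟨X', hsub, subset_rfl⟩
  have hgood : Sweepable G S m (X' ∩ Y) := hX'.inter fun W hW =>
    hmin _ ⟨hY1.trans Set.subset_union_left, Set.union_subset hY2 hW⟩
  rw [Set.inter_eq_right.2 hY2] at hgood
  have hmem : (Y₀ ∪ X) ∩ X' ∈ {Y | insert u X ⊆ Y ∧ Y ⊆ X'} :=
    ⟨Set.subset_inter (Set.insert_subset (Or.inl (hY₀ (Or.inl rfl))) Set.subset_union_right) hsub,
      Set.inter_subset_right⟩
  exact absurd ((hmin _ hmem).trans hY₁) (not_le.2 (hno Y hgood hY1))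

/-! ### Growing a model of a forest -/

/-- `B` restricted to `U` is a model in `G` of the subgraph of `F` induced on `U`. -/
structure IsModelOn (F : SimpleGraph W) (G : SimpleGraph V) (U : Set W) (B : W → Set V) :
    Prop where
  disjoint : ∀ x ∈ U, ∀ y ∈ U, x ≠ y → Disjoint (B x) (B y)
  connected : ∀ x ∈ U, (G.induce (B x)).Connected
  adj : ∀ x ∈ U, ∀ y ∈ U, F.Adj x y → ∃ u ∈ B x, ∃ v ∈ B y, G.Adj u v

/-- A model whose branch sets each contain a boundary vertex of `X` can be extended by one branch
set, along any linkage that leaves `X` through its boundary and one more vertex. -/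
lemma IsModelOn.exists_extension [Finite V] [Finite W] {F : SimpleGraph W} {G : SimpleGraph V}
    {U : Set W} {B : W → Set V} {X : Set V} (hB : IsModelOn F G U B) (hBX : ∀ y ∈ U, B y ⊆ X)
    (hbd : ∀ y ∈ U, (B y ∩ boundary G X).Nonempty) (hcard : (boundary G X).ncard ≤ U.ncard)
    {x : W} (hx : x ∉ U) (hdeg : ∀ y ∈ U, ∀ z ∈ U, F.Adj x y → F.Adj x z → y = z)
    (hX : X ≠ Set.univ) :
    ∃ u ∉ X, ∀ R A : Set V, R ∩ X ⊆ boundary G X → insert u (boundary G X) ⊆ R →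
      Linked (within G R) (insert u (boundary G X)) A (U.ncard + 1) →
      ∃ B' : W → Set V, IsModelOn F G (insert x U) B' ∧
        ∀ y ∈ insert x U, B' y ⊆ X ∪ R ∧ (B' y ∩ A).Nonempty := by
  classical
  have hex : ∀ y, ∃ v, y ∈ U → v ∈ B y ∩ boundary G X := fun y => by
    by_cases hy : y ∈ U
    · obtain ⟨v, hv⟩ := hbd y hy
      exact ⟨v, fun _ => hv⟩
    · obtain ⟨v, -⟩ := (Set.ne_univ_iff_exists_notMem X).1 hX
      exact ⟨v, fun h => absurd h hy⟩
  choose b hb using hex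
  have hinj : Set.InjOn b U := by
    intro y hy z hz hyz
    by_contra hne
    exact Set.disjoint_left.1 (hB.disjoint y hy z hz hne) (hb y hy).1 (hyz ▸ (hb z hz).1)
  -- Hence `b` is a bijection from `U` onto the boundary.
  have hUc : (boundary G X).ncard = U.ncard := by
    refine le_antisymm hcard ?_
    rw [← hinj.ncard_image]
    exact Set.ncard_le_ncard (by rintro _ ⟨y, hy, rfl⟩; exact (hb y hy).2)
  -- The new branch set starts at `u`, which must be adjacent only to the branch set of the single
  -- possible neighbour of `x`. It is fixed before `R` and `A` because the next sweepable set is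
  -- chosen to contain it.
  obtain ⟨u, huX, hu⟩ : ∃ u ∉ X, ∀ y ∈ U, F.Adj x y → G.Adj (b y) u := by
    by_cases h : ∃ y ∈ U, F.Adj x y
    · obtain ⟨y, hy, hxy⟩ := h
      obtain ⟨-, u, hu, hyu⟩ := (hb y hy).2
      exact ⟨u, hu, fun z hz hxz => hdeg y hy z hz hxy hxz ▸ hyu⟩
    · obtain ⟨u, hu⟩ := (Set.ne_univ_iff_exists_notMem X).1 hX
      exact ⟨u, hu, fun y hy hxy => absurd ⟨y, hy, hxy⟩ h⟩
  refine ⟨u, huX, fun R A hRX hAR hlink => ?_⟩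
  have hub : u ∉ boundary G X := fun h => huX h.1
  obtain ⟨C, hC, hCd⟩ := hlink.index (by rw [Set.ncard_insert_of_notMem hub, hUc])
  have hCR : ∀ a ∈ insert u (boundary G X), C a ⊆ R := fun a ha =>
    subset_of_connected_within (hC a ha).2.1 ⟨a, (hC a ha).1, hAR ha⟩
  have hbmem : ∀ y ∈ U, b y ∈ insert u (boundary G X) := fun y hy => Or.inr (hb y hy).2
  have hBC : ∀ y ∈ U, ∀ a ∈ insert u (boundary G X), a ∉ B y → Disjoint (B y) (C a) := by
    intro y hy a ha hay
    rw [Set.disjoint_left]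
    intro z hzB hzC
    -- The linkage meets `X` only in the boundary, each vertex of which lies in its own linkage set.
    have hz : z ∈ insert u (boundary G X) := Or.inr (hRX ⟨hCR a ha hzC, hBX y hy hzB⟩)
    have hza : z ≠ a := fun h => hay (h ▸ hzB)
    exact Set.disjoint_left.1 (hCd z hz a ha hza) (hC z hz).1 hzC
  have hby : ∀ y ∈ U, ∀ z ∈ U, y ≠ z → b z ∉ B y := fun y hy z hz hne h =>
    Set.disjoint_left.1 (hB.disjoint y hy z hz hne) h (hb z hz).1
  let B' : W → Set V := fun y => if y = x then C u else B y ∪ C (b y)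
  have hB'x : B' x = C u := if_pos rfl
  have hB'U : ∀ y ∈ U, B' y = B y ∪ C (b y) := fun y hy =>
    if_neg fun h : y = x => hx (h ▸ hy)
  have hdxy : ∀ y ∈ U, Disjoint (B' x) (B' y) := by
    intro y hy
    rw [hB'x, hB'U y hy, Set.disjoint_union_right]
    exact ⟨(hBC y hy u (Or.inl rfl) fun h => huX (hBX y hy h)).symm,
      hCd _ (Or.inl rfl) _ (hbmem y hy) fun h => hub (h ▸ (hb y hy).2)⟩
  have hadjx : ∀ y ∈ U, F.Adj x y → ∃ v ∈ B' y, G.Adj v u := fun y hy hxy =>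
    ⟨b y, by rw [hB'U y hy]; exact Or.inl (hb y hy).1, hu y hy hxy⟩
  have huB' : u ∈ B' x := by rw [hB'x]; exact (hC u (Or.inl rfl)).1
  refine ⟨B', ⟨?_, ?_, ?_⟩, ?_⟩
  · rintro y (rfl | hy) z (rfl | hz) hne
    · exact absurd rfl hne
    · exact hdxy z hz
    · exact (hdxy y hy).symm
    · rw [hB'U y hy, hB'U z hz]
      simp only [Set.disjoint_union_left, Set.disjoint_union_right]
      exact ⟨⟨hB.disjoint y hy z hz hne, (hBC z hz _ (hbmem y hy) (hby z hz y hy hne.symm)).symm⟩,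
        hBC y hy _ (hbmem z hz) (hby y hy z hz hne),
        hCd _ (hbmem y hy) _ (hbmem z hz) fun h => hne (hinj hy hz h)⟩
  · rintro y (rfl | hy)
    · rw [hB'x]
      exact induce_connected_mono (within_le _ _) (hC u (Or.inl rfl)).2.1
    · rw [hB'U y hy]
      exact SimpleGraph.induce_union_connected (hB.connected y hy).preconnected
        (induce_connected_mono (within_le _ _) (hC _ (hbmem y hy)).2.1).preconnected
        ⟨b y, (hb y hy).1, (hC _ (hbmem y hy)).1⟩
  · rintro y (rfl | hy) z (rfl | hz) hyz
    · exact absurd rfl hyz.ne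
    · obtain ⟨v, hv, hvu⟩ := hadjx z hz hyz
      exact ⟨u, huB', v, hv, hvu.symm⟩
    · obtain ⟨v, hv, hvu⟩ := hadjx y hy hyz.symm
      exact ⟨v, hv, u, huB', hvu⟩
    · obtain ⟨v, hv, w, hw, hvw⟩ := hB.adj y hy z hz hyz
      rw [hB'U y hy, hB'U z hz]
      exact ⟨v, Or.inl hv, w, Or.inl hw, hvw⟩
  · rintro y (rfl | hy)
    · rw [hB'x]
      exact ⟨(hCR u (Or.inl rfl)).trans Set.subset_union_right, (hC u (Or.inl rfl)).2.2⟩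
    · rw [hB'U y hy]
      exact ⟨Set.union_subset_union (hBX y hy) (hCR _ (hbmem y hy)),
        (hC _ (hbmem y hy)).2.2.mono (Set.inter_subset_inter_left _ Set.subset_union_right)⟩

/-- Every non-empty set of vertices contains a vertex with at most one neighbour in the set. -/
def IsOneDegenerate (F : SimpleGraph W) : Prop :=
  ∀ U : Set W, U.Nonempty → ∃ x ∈ U, ∀ y ∈ U, ∀ z ∈ U, F.Adj x y → F.Adj x z → y = z

lemma exists_maximal_sweepable [Finite V] {G : SimpleGraph V} {S : Set V} {m : ℕ} {X : Set V}
    (hX : Sweepable G S m X) {i : ℕ} (hi : (boundary G X).ncard ≤ i) :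
    ∃ Y, X ⊆ Y ∧ Sweepable G S m Y ∧ (boundary G Y).ncard ≤ i ∧
      ∀ Z, Sweepable G S m Z → Y ⊆ Z → (boundary G Z).ncard ≤ i → Z = Y := by
  obtain ⟨Y, hXY, hY⟩ := (Set.toFinite {Y | Sweepable G S m Y ∧ (boundary G Y).ncard ≤ i}
    ).exists_le_maximal (a := X) ⟨hX, hi⟩
  exact ⟨Y, hXY, hY.prop.1, hY.prop.2, fun Z hZ hYZ hZi => (hY.eq_of_subset ⟨hZ, hZi⟩ hYZ).symm⟩

/-- Diestel's construction: unless everything can be swept, every small induced subgraph of `F` has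
a model in a maximal sweepable set, each of its branch sets containing a boundary vertex. -/
lemma exists_model_meeting_boundary [Finite V] [Finite W] {F : SimpleGraph W}
    (hF : IsOneDegenerate F) (G : SimpleGraph V) (S : Set V) (m : ℕ)
    (huniv : ¬ Sweepable G S m Set.univ) : ∀ (n : ℕ) (U : Set W), U.ncard = n → n ≤ m →
    ∃ (X : Set V) (B : W → Set V), Sweepable G S m X ∧ (boundary G X).ncard ≤ n ∧
      (∀ Y, Sweepable G S m Y → X ⊆ Y → (boundary G Y).ncard ≤ n → Y = X) ∧
      IsModelOn F G U B ∧ (∀ y ∈ U, B y ⊆ X) ∧ ∀ y ∈ U, (B y ∩ boundary G X).Nonempty := by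
  intro n
  induction n with
  | zero =>
    intro U hU _
    rw [Set.ncard_eq_zero] at hU
    subst hU
    obtain ⟨X, -, hX, hXi, hmax⟩ := exists_maximal_sweepable (G := G) (S := S) (m := m) .empty
      (i := 0) (by simp [boundary])
    exact ⟨X, fun _ => ∅, hX, hXi, hmax, ⟨by simp, by simp, by simp⟩, by simp, by simp⟩
  | succ n ih =>
    intro U hU hnm
    obtain ⟨x, hxU, hdeg⟩ := hF U (Set.nonempty_of_ncard_ne_zero (by omega))
    have hU' : (U \ {x}).ncard = n := by rw [Set.ncard_sdiff_singleton_of_mem hxU, hU]; rfl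
    obtain ⟨X, B, hX, hXn, hmax, hB, hBX, hbd⟩ := ih (U \ {x}) hU' (by omega)
    obtain ⟨u, huX, hext⟩ := hB.exists_extension hBX hbd (hU'.symm ▸ hXn) (x := x) (by simp)
      (fun y hy z hz => hdeg y hy.1 z hz.1) (fun h => huniv (h ▸ hX))
    -- Adding `u` alone is a legal sweep step, since its bag has at most `n + 1 ≤ m` vertices.
    have hsub : boundary G (insert u X) ∪ (S ∩ (insert u X \ X)) ⊆ insert u (boundary G X) := by
      rintro v (⟨rfl | hv, w, hw, hvw⟩ | ⟨-, rfl | hv, hvX⟩)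
      · exact Or.inl rfl
      · exact Or.inr ⟨hv, w, fun h => hw (Or.inr h), hvw⟩
      · exact Or.inl rfl
      · exact absurd hv hvX
    have hle : (boundary G (insert u X) ∪ (S ∩ (insert u X \ X))).ncard ≤ n + 1 :=
      (Set.ncard_le_ncard hsub).trans ((Set.ncard_insert_le _ _).trans (by omega))
    obtain ⟨X', hXX', hX', hX'n, hmax'⟩ := exists_maximal_sweepable
      (.step hX (Set.subset_insert u X) (hle.trans hnm))
      ((Set.ncard_le_ncard Set.subset_union_left).trans hle)
    have hlink := hX'.linked_boundary hXX' (i := n) fun Y hY hXY => by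
      by_contra hlt
      rw [hmax Y hY ((Set.subset_insert _ _).trans hXY) (not_lt.1 hlt)] at hXY
      exact huX (hXY (Or.inl rfl))
    rw [hU'] at hext
    have hXX'₁ : X ⊆ X' := (Set.subset_insert _ _).trans hXX'
    obtain ⟨B', hB', hB''⟩ := hext (X' \ (X \ boundary G X)) _
      (fun v hv => by
        by_contra h
        exact hv.1.2 ⟨hv.2, h⟩)
      (Set.insert_subset ⟨hXX' (Or.inl rfl), fun h => huX h.1⟩
        fun v hv => ⟨hXX'₁ hv.1, fun h => h.2 hv⟩) hlink
    rw [Set.insert_sdiff_singleton, Set.insert_eq_of_mem hxU] at hB' hB''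
    exact ⟨X', B', hX', hX'n, hmax', hB',
      fun y hy => (hB'' y hy).1.trans (Set.union_subset hXX'₁ Set.sdiff_subset),
      fun y hy => (hB'' y hy).2⟩

/-- A graph without an `S`-rooted model of a forest on `m + 1` vertices can be swept with sets
of size at most `m`. -/
theorem sweepable_univ_or_hasRootedModel [Finite V] [Finite W] {F : SimpleGraph W}
    (hF : IsOneDegenerate F) (G : SimpleGraph V) (S : Set V) (m : ℕ) (hm : Nat.card W = m + 1) :
    Sweepable G S m Set.univ ∨ HasRootedModel F G S := by
  by_contra! ⟨huniv, hno⟩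
  have : Nonempty W := (Nat.card_pos_iff.1 (by omega)).1
  obtain ⟨x, -, hdeg⟩ := hF Set.univ Set.univ_nonempty
  have hU : (Set.univ \ {x} : Set W).ncard = m := by
    rw [Set.ncard_sdiff_singleton_of_mem (Set.mem_univ x), Set.ncard_univ, hm]; rfl
  obtain ⟨X, B, hX, hXm, hmax, hB, hBX, hbd⟩ :=
    exists_model_meeting_boundary hF G S m huniv m _ hU le_rfl
  obtain ⟨u, huX, hext⟩ := hB.exists_extension hBX hbd (hU.symm ▸ hXm) (x := x) (by simp)
    (fun y hy z hz => hdeg y hy.1 z hz.1) (fun h => huniv (h ▸ hX))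
  rw [hU] at hext
  have hlink : Linked (within G (X \ boundary G X)ᶜ) (insert u (boundary G X)) S (m + 1) := by
    -- A cut `Y₀` of size at most `m` would make `Y₀ ∪ X` a further sweep step, contradicting the
    -- maximality of `X`.
    refine menger _ _ _ _ fun Y₀ hY₀ => ?_
    by_contra hlt
    have hsub : boundary G (Y₀ ∪ X) ∪ (S ∩ ((Y₀ ∪ X) \ X)) ⊆
        boundary (within G (X \ boundary G X)ᶜ) Y₀ ∪ (S ∩ Y₀) := by
      rintro a (⟨ha, b, hb, hab⟩ | ⟨haS, ha, haX⟩)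
      · have hbX : b ∉ X := fun h => hb (Or.inr h)
        have haY₀ : a ∈ Y₀ := ha.elim id fun h => hY₀ (Or.inr ⟨h, b, hbX, hab⟩)
        exact Or.inl ⟨haY₀, b, fun h => hb (Or.inl h), hab, fun h => h.2 ⟨h.1, b, hbX, hab⟩,
          fun h => hbX h.1⟩
      · exact Or.inr ⟨haS, ha.resolve_right haX⟩
    have hle := (Set.ncard_le_ncard hsub).trans (Nat.lt_succ_iff.1 (not_le.1 hlt))
    have heq := hmax _ (.step hX Set.subset_union_right hle) Set.subset_union_right
      ((Set.ncard_le_ncard Set.subset_union_left).trans hle)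
    exact huX (heq ▸ Or.inl (hY₀ (Or.inl rfl)))
  obtain ⟨B', hB', hB''⟩ := hext (X \ boundary G X)ᶜ _
    (fun v hv => by
      by_contra h
      exact hv.1 ⟨hv.2, h⟩)
    (Set.insert_subset (fun h => huX h.1) fun v hv h => h.2 hv) hlink
  rw [Set.insert_sdiff_singleton, Set.insert_eq_of_mem (Set.mem_univ x)] at hB' hB''
  exact hno ⟨B', ⟨⟨fun x y => hB'.disjoint x trivial y trivial, fun x => hB'.connected x trivial,
    fun x y => hB'.adj x trivial y trivial⟩, fun x => (hB'' x trivial).2⟩⟩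

/-! ### Greedy packing along a sweep -/

lemma subset_or_disjoint_of_disjoint_boundary {G : SimpleGraph V} {U X : Set V}
    (hU : (G.induce U).Connected) (hd : Disjoint U (boundary G X)) : U ⊆ X ∨ Disjoint U X := by
  rw [or_iff_not_imp_right, Set.not_disjoint_iff_nonempty_inter]
  intro hmeet
  refine subset_of_connected hU hmeet fun a ha b _ haX hab => ?_
  by_contra hb
  exact Set.disjoint_left.1 hd ha ⟨haX, b, hb, hab⟩

/-- Greedy packing along a sweep: the sets of a family of connected sets meeting `S` are packed
into `L`, and every further set of the family inside `X` is hit by `Z`. -/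
lemma Sweepable.exists_packing [Finite V] {G : SimpleGraph V} {S : Set V} {m : ℕ} {X : Set V}
    (hX : Sweepable G S m X) (𝓜 : Set (Set V)) (hconn : ∀ U ∈ 𝓜, (G.induce U).Connected)
    (hroot : ∀ U ∈ 𝓜, (U ∩ S).Nonempty) :
    ∃ (j : ℕ) (M : Fin j → Set V) (L Z : Set V), (∀ i, M i ∈ 𝓜 ∧ M i ⊆ L) ∧
      (∀ i i', i ≠ i' → Disjoint (M i) (M i')) ∧ L ⊆ X ∧ Z.ncard ≤ 2 * m * j ∧
      ∀ U ∈ 𝓜, Disjoint U Z → Disjoint U L ∧ ¬ U ⊆ X := by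
  -- Of the two conclusions for a set missing `Z`, disjointness from `L` lets it be packed next, and
  -- not lying in `X` shows that none is left once `X` is everything.
  induction hX with
  | empty =>
    refine ⟨0, Fin.elim0, ∅, ∅, fun i => i.elim0, fun i => i.elim0, subset_rfl, by simp,
      fun U hU _ => ⟨Set.disjoint_empty _, fun h => ?_⟩⟩
    obtain ⟨v, hv, -⟩ := hroot U hU
    exact h hv
  | @step X Y hX hXY hcard ih =>
    obtain ⟨j, M, L, Z, hM, hMd, hLX, hZ, hU⟩ := ih
    by_cases hnew : ∃ U ∈ 𝓜, Disjoint U Z ∧ U ⊆ Y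
    · obtain ⟨U₀, hU₀, hU₀Z, hU₀Y⟩ := hnew
      have hU₀M : ∀ i, Disjoint U₀ (M i) := fun i =>
        (hU U₀ hU₀ hU₀Z).1.mono_right (hM i).2
      refine ⟨j + 1, Fin.cons U₀ M, Y,
        Z ∪ (boundary G X ∪ (boundary G Y ∪ (S ∩ (Y \ X)))), ?_, ?_, subset_rfl, ?_, ?_⟩
      · intro i
        cases i using Fin.cases with
        | zero => exact ⟨hU₀, hU₀Y⟩
        | succ i => exact ⟨(hM i).1, (hM i).2.trans (hLX.trans hXY)⟩
      · intro i i' hii'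
        cases i using Fin.cases with
        | zero =>
          cases i' using Fin.cases with
          | zero => exact absurd rfl hii'
          | succ i' => exact hU₀M i'
        | succ i =>
          cases i' using Fin.cases with
          | zero => exact (hU₀M i).symm
          | succ i' => exact hMd i i' fun h => hii' (h ▸ rfl)
      · have h1 := Set.ncard_union_le Z (boundary G X ∪ (boundary G Y ∪ (S ∩ (Y \ X))))
        have h2 := Set.ncard_union_le (boundary G X) (boundary G Y ∪ (S ∩ (Y \ X)))
        have h3 := hX.ncard_boundary_le
        rw [mul_add, mul_one]
        omega
      -- Avoiding the boundary of `X` forces `U` off `X`. Its roots are then not in `Y`, as `U`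
      -- avoids `S ∩ (Y \ X)`, so `U` is not inside `Y`; avoiding the boundary of `Y`, it misses
      -- `Y`.
      · intro U hUM hUd
        simp only [Set.disjoint_union_right] at hUd
        obtain ⟨hUZ, hUX, hUY, hUS⟩ := hUd
        have hdX : Disjoint U X :=
          (subset_or_disjoint_of_disjoint_boundary (hconn U hUM) hUX).resolve_left
            (hU U hUM hUZ).2
        obtain ⟨s, hsU, hsS⟩ := hroot U hUM
        have hnY : ¬ U ⊆ Y := fun h =>
          Set.disjoint_left.1 hUS hsU ⟨hsS, h hsU, Set.disjoint_left.1 hdX hsU⟩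
        exact ⟨(subset_or_disjoint_of_disjoint_boundary (hconn U hUM) hUY).resolve_left hnY, hnY⟩
    · push Not at hnew
      exact ⟨j, M, L, Z, hM, hMd, hLX.trans hXY, hZ, fun U hUM hUZ =>
        ⟨(hU U hUM hUZ).1, hnew U hUM hUZ⟩⟩

/-! ### Forests, copies and models -/

/-- The disjoint union of copies of `T`, indexed by `ι`. -/
def copies (ι : Type*) (T : SimpleGraph W) : SimpleGraph (ι × W) where
  Adj p q := p.1 = q.1 ∧ T.Adj p.2 q.2
  symm := ⟨fun _ _ h => ⟨h.1.symm, h.2.symm⟩⟩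
  loopless := ⟨fun _ h => T.loopless.irrefl _ h.2⟩

lemma IsOneDegenerate.copies (ι : Type*) {T : SimpleGraph W} (hT : IsOneDegenerate T) :
    IsOneDegenerate (copies ι T) := by
  rintro U ⟨⟨i, w⟩, hw⟩
  obtain ⟨x, hx, hdeg⟩ := hT {w | (i, w) ∈ U} ⟨w, hw⟩
  refine ⟨(i, x), hx, ?_⟩
  rintro ⟨i₁, y⟩ hy ⟨i₂, z⟩ hz ⟨rfl, hxy⟩ ⟨rfl, hxz⟩
  exact Prod.ext rfl (hdeg y hy z hz hxy hxz)

/-- The forest induced on `U` extends to a tree on `U`, and a leaf of that tree has at most one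
neighbour in the forest. -/
lemma isOneDegenerate_of_isAcyclic [Finite W] {T : SimpleGraph W} (hT : T.IsAcyclic) :
    IsOneDegenerate T := by
  classical
  intro U hU
  have : Fintype U := Fintype.ofFinite U
  have : Nonempty U := hU.to_subtype
  obtain ⟨F, hF, -, hFt⟩ := (SimpleGraph.connected_top (V := U)).exists_isTree_le_of_le_of_isAcyclic
    (H := T.induce U) le_top (hT.induce U)
  rcases subsingleton_or_nontrivial U with hs | hn
  · obtain ⟨x, hx⟩ := hU
    exact ⟨x, hx, fun y hy z hz _ _ =>
      congrArg Subtype.val (Subsingleton.elim (⟨y, hy⟩ : U) ⟨z, hz⟩)⟩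
  · obtain ⟨x, hx⟩ := hFt.exists_vert_degree_one_of_nontrivial
    obtain ⟨w, -, hw⟩ := SimpleGraph.degree_eq_one_iff_existsUnique_adj.1 hx
    refine ⟨x, x.2, fun y hy z hz hxy hxz => ?_⟩
    have h1 := hw ⟨y, hy⟩ (hF hxy)
    have h2 := hw ⟨z, hz⟩ (hF hxz)
    exact congrArg Subtype.val (h1.trans h2.symm)

lemma HasRootedModel.hasDisjointRootedModels {T : SimpleGraph W} {G : SimpleGraph V} {S : Set V}
    {k : ℕ} (h : HasRootedModel (copies (Fin k) T) G S) : HasDisjointRootedModels T G S k := by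
  obtain ⟨B, hB⟩ := h
  refine ⟨fun i x => B (i, x), fun i => ⟨⟨fun x y hxy => hB.disjoint _ _ fun h => hxy ?_,
    fun x => hB.connected _, fun x y hxy => hB.adj _ _ ⟨rfl, hxy⟩⟩, fun x => hB.rooted _⟩, ?_⟩
  · exact congrArg Prod.snd h
  · intro i j hij
    simp only [Set.disjoint_iUnion_left, Set.disjoint_iUnion_right]
    exact fun x y => hB.disjoint _ _ fun h => hij (congrArg Prod.fst h)

lemma IsModel.connected_iUnion [Nonempty W] {T : SimpleGraph W} {G : SimpleGraph V}
    {B : W → Set V} (hB : IsModel T G B) (hT : T.Preconnected) :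
    (G.induce (⋃ x, B x)).Connected := by
  have hsub : ∀ x, B x ⊆ ⋃ x, B x := Set.subset_iUnion B
  have hin : ∀ x u v (hu : u ∈ B x) (hv : v ∈ B x),
      (G.induce (⋃ x, B x)).Reachable ⟨u, hsub x hu⟩ ⟨v, hsub x hv⟩ := fun x u v hu hv =>
    ((hB.connected x).preconnected ⟨u, hu⟩ ⟨v, hv⟩).map
      (SimpleGraph.induceHomOfLE G (hsub x)).toHom
  have key : ∀ x y, T.Walk x y → ∀ u v (hu : u ∈ B x) (hv : v ∈ B y),
      (G.induce (⋃ x, B x)).Reachable ⟨u, hsub x hu⟩ ⟨v, hsub y hv⟩ := by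
    intro x y p
    induction p with
    | nil => exact hin _
    | @cons x x' y hadj _ ih =>
      intro u v hu hv
      obtain ⟨a, ha, b, hb, hab⟩ := hB.adj _ _ hadj
      have hab' : (G.induce (⋃ x, B x)).Adj ⟨a, hsub x ha⟩ ⟨b, hsub x' hb⟩ := hab
      exact (hin x u a hu ha).trans (hab'.reachable.trans (ih b v hb hv))
  obtain ⟨x⟩ := ‹Nonempty W›
  obtain ⟨⟨v, hv⟩⟩ := (hB.connected x).nonempty
  have : Nonempty (⋃ x, B x : Set V) := ⟨⟨v, hsub x hv⟩⟩
  refine ⟨?_⟩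
  rintro ⟨u, hu⟩ ⟨v, hv⟩
  obtain ⟨x, hx⟩ := Set.mem_iUnion.1 hu
  obtain ⟨y, hy⟩ := Set.mem_iUnion.1 hv
  obtain ⟨p⟩ := hT x y
  exact key x y p u v hx hy

/-- A rooted model in an induced subgraph is a rooted model in the whole graph. -/
lemma IsRootedModel.image_val {T : SimpleGraph W} {G : SimpleGraph V} {S R : Set V}
    {B : W → Set R} (hB : IsRootedModel T (G.induce R) (Subtype.val ⁻¹' S) B) :
    IsRootedModel T G S fun x => Subtype.val '' B x := by
  refine ⟨⟨fun x y hxy => ?_, fun x => ?_, fun x y hxy => ?_⟩, fun x => ?_⟩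
  · exact (Set.disjoint_image_iff Subtype.val_injective).2 (hB.disjoint x y hxy)
  · let f : (G.induce R).induce (B x) →g G.induce (Subtype.val '' B x) :=
      ⟨fun v => ⟨v.1.1, v.1, v.2, rfl⟩, fun h => h⟩
    refine (hB.connected x).map f ?_
    rintro ⟨_, v, hv, rfl⟩
    exact ⟨⟨v, hv⟩, rfl⟩
  · obtain ⟨u, hu, v, hv, huv⟩ := hB.adj x y hxy
    exact ⟨u, ⟨u, hu, rfl⟩, v, ⟨v, hv, rfl⟩, huv⟩
  · obtain ⟨v, hv, hvS⟩ := hB.rooted x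
    exact ⟨v, ⟨v, hv, rfl⟩, hvS⟩

end RootedMinor

/-! ### The Erdős–Pósa bound -/

theorem mainTheorem11 {W V : Type*} [Fintype W] [Finite V]
    (T : SimpleGraph W) (hconn : T.Preconnected) (hacyc : T.IsAcyclic)
    (G : SimpleGraph V) (S : Set V) (k : ℕ) (hk : 1 ≤ k) :
    RootedMinor.HasDisjointRootedModels T G S k ∨
      ∃ Z : Finset V,
        (Z.card : ℤ) ≤ (2 * (k : ℤ) * (Fintype.card W : ℤ) - 1) * ((k : ℤ) - 1) ∧
        ¬ RootedMinor.HasRootedModel T (G.induce ((Z : Set V)ᶜ))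
          ((Subtype.val : ((Z : Set V)ᶜ : Set V) → V) ⁻¹' S) := by
  open RootedMinor in
  rcases isEmpty_or_nonempty W with hW | hW
  · exact Or.inl ⟨fun _ => isEmptyElim, fun _ => ⟨⟨isEmptyElim, isEmptyElim, isEmptyElim⟩,
      isEmptyElim⟩, fun _ _ _ => by simp⟩
  obtain ⟨m, hm⟩ : ∃ m, k * Fintype.card W = m + 1 :=
    Nat.exists_eq_succ_of_ne_zero (Nat.mul_ne_zero (by omega) Fintype.card_ne_zero)
  rcases sweepable_univ_or_hasRootedModel ((isOneDegenerate_of_isAcyclic hacyc).copies (Fin k)) G S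
    m (by simpa using hm) with hsweep | hmodel
  swap
  · exact Or.inl hmodel.hasDisjointRootedModels
  obtain ⟨j, M, L, Z, hM, hMd, -, hZ, hhit⟩ := hsweep.exists_packing
    {U | ∃ B, IsRootedModel T G S B ∧ U = ⋃ x, B x}
    -- Connectedness of `T` enters only here: the packing needs the union of the branch sets to be
    -- connected.
    (by rintro _ ⟨B, hB, rfl⟩; exact hB.connected_iUnion hconn)
    (by
      rintro _ ⟨B, hB, rfl⟩
      obtain ⟨x⟩ := hW
      exact (hB.rooted x).mono (Set.inter_subset_inter_left _ (Set.subset_iUnion B x)))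
  rcases le_or_gt k j with hkj | hjk
  · left
    choose B hB hBM using fun i => (hM i).1
    refine ⟨fun i => B (Fin.castLE hkj i), fun i => hB _, fun i i' hii' => ?_⟩
    rw [← hBM, ← hBM]
    exact hMd _ _ fun h => hii' (Fin.castLE_injective hkj h)
  · right
    refine ⟨(Set.toFinite Z).toFinset, ?_, ?_⟩
    · rw [← Set.ncard_eq_toFinset_card]
      obtain ⟨k, rfl⟩ := Nat.exists_eq_add_of_lt hjk
      -- The packing bound `2 * m * j` is relaxed to the stated one: `2 * m + 1` is the factor `2 *
      -- k * |W| - 1` for the original `k`, and `j + k` is the original `k` minus one.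
      have h1 : Z.ncard ≤ (2 * m + 1) * (j + k) :=
        hZ.trans (Nat.mul_le_mul (Nat.le_succ _) (Nat.le_add_right _ _))
      have h2 : ((j + k + 1 : ℕ) : ℤ) * (Fintype.card W : ℤ) = m + 1 := by exact_mod_cast hm
      rw [mul_assoc, h2]
      push_cast
      zify at h1
      linarith
    · rintro ⟨B, hB⟩
      refine (hhit _ ⟨_, hB.image_val, rfl⟩ ?_).2 (Set.subset_univ _)
      simp only [Set.disjoint_iUnion_left]
      intro x
      rw [Set.disjoint_left]
      rintro _ ⟨v, -, rfl⟩ hv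
      exact v.2 (by simpa using hv)
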